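/- A lattice polytope in $\mathbb{R}^d$ is the convex hull of a nonempty finite subset of $\mathbb{Z}^d$; it is a $0/1$-polytope if it is the convex hull of a nonempty subset of $\{0,1\}^d$. Its Ehrhart polynomial is the polynomial $i_P$ with $i_P(n)=\#(nP\cap\mathbb{Z}^d)$ for all integers $n\ge 1$. For $d\ge 1$ let $P_d\subset\mathbb{R}^d$ be the order polytope $\{(x_0,\dots,x_{d-1}) : 0\le x_0\le x_k\le 1 \text{ for } 0\le k\le d-1\}$, and let $B_d$ be the $d$-th Bernoulli polynomial. **Theorem 1.3.** (i) For every real $t>0$ and every sufficiently large $d$ there is a $d$-dimensional lattice polytope in $\mathbb{R}^d$ whose Ehrhart polynomial has degree $d$ and a real root strictly larger than $t$. (ii) For every $d\ge 1$ there are a $d$-dimensional $0/1$-polytope in $\mathbb{R}^d$ and a real zero $\alpha_d$ of its Ehrhart polynomial such that $\lim_{d\to\infty}\alpha_d/d=1/(2\pi e)=0.0585\cdots$. Moreover, whenever $4\nmid d$ the polytope can be taken to be $P_d$. (iii) For every $d\ge1$, $P_d$ is a $d$-dimensional $0/1$-polytope, and for every $d\ge 2$ its Ehrhart polynomial is $$i_{P_d}(n)=\frac{B_d(n+2)-B_d(0)}{d}.$$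 -/

import Mathlib

open Filter Topology Polynomial
open scoped Pointwise

/-- The point of `ℝ^d` with the given integer coordinates. -/
def intPoint {d : ℕ} (z : Fin d → ℤ) : Fin d → ℝ := fun i => (z i : ℝ)

/-- A lattice polytope in `ℝ^d`: the convex hull of a finite nonempty set of points of `ℤ^d`. -/
def IsLatticePolytope {d : ℕ} (P : Set (Fin d → ℝ)) : Prop :=
  ∃ V : Finset (Fin d → ℤ), V.Nonempty ∧ P = convexHull ℝ (intPoint '' (V : Set (Fin d → ℤ)))

/-- A 0/1-polytope in `ℝ^d`: the convex hull of a nonempty set of points of `{0, 1}^d`. -/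
def IsZeroOnePolytope {d : ℕ} (P : Set (Fin d → ℝ)) : Prop :=
  ∃ V : Set (Fin d → ℝ), V.Nonempty ∧ (∀ v ∈ V, ∀ i, v i = 0 ∨ v i = 1) ∧ P = convexHull ℝ V

/-- The dimension of `P`, that is, of its affine hull. -/
noncomputable def polytopeDim {d : ℕ} (P : Set (Fin d → ℝ)) : ℕ :=
  Module.finrank ℝ (vectorSpan ℝ P)

/-- The number of points of `ℤ^d` in the dilate `n P`. -/
noncomputable def latticeCount {d : ℕ} (P : Set (Fin d → ℝ)) (n : ℕ) : ℕ :=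
  Set.ncard {z : Fin d → ℤ | intPoint z ∈ (n : ℝ) • P}

/-- `p` is the Ehrhart polynomial of `P`: its value at every positive integer `n` is the number of
lattice points of `n P`. There is at most one such `p`. -/
def IsEhrhartPolynomial {d : ℕ} (P : Set (Fin d → ℝ)) (p : ℝ[X]) : Prop :=
  ∀ n : ℕ, 1 ≤ n → p.eval (n : ℝ) = (latticeCount P n : ℝ)

/-- The order polytope `0 ≤ x₀ ≤ x_k ≤ 1` in `ℝ^d`, with coordinates `x₀, …, x_{d-1}`. -/
def orderPolytope (d : ℕ) : Set (Fin d → ℝ) :=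
  {x | ∀ i k : Fin d, i.val = 0 → 0 ≤ x i ∧ x i ≤ x k ∧ x k ≤ 1}

/-- The polynomial `(B_d(X + 2) - B_d(0)) / d`, where `B_d` is the Bernoulli polynomial. -/
noncomputable def bernoulliEhrhart (d : ℕ) : ℝ[X] :=
  let B : ℝ[X] := (Polynomial.bernoulli d).map (algebraMap ℚ ℝ)
  C ((d : ℝ)⁻¹) * (B.comp (X + C 2) - C (B.eval 0))

/-!
A lattice point of `n P_d` is an order-preserving map into `{0, …, n}`, so the lattice points are
counted by a sum of `(d - 1)`-st powers, which is a difference of values of `B_d`. A root of the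
Ehrhart polynomial is thus, up to a shift by `2`, a point where `B_d` takes the value `B_d(0)`.

On `[0, 1]` the leading Fourier term of `B_d` is `-2 d! / (2π)^d * cos (2πx - dπ/2)`, so for
`4 ∤ d` the value `B_d(0)` stays above the minimum by at least `d! / (2 (2π)^d)`. On `[m, m + 1]`
the difference from the values on `[0, 1]` is at most `(m + 1)^d`, and since `d! ≥ (d / e)^d` the
dip below `B_d(0)` survives up to `m ≈ d / (2πe)`. As `B_d(m) ≥ B_d(0)`, this puts a root within a
bounded distance of `d / (2πe)`. If `4 ∣ d`, the prism over `P_{d-1}` has the same root as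
`P_{d-1}`.
-/

open scoped Nat Real

/-- The order polytope of a relation `r`: the points of the unit cube whose coordinates are weakly
increasing along `r`. For a partial order this is Stanley's order polytope; here `r` need not be
transitive or antisymmetric, so that a generating set of relations can be used. -/
def relOrderPolytope {d : ℕ} (r : Fin d → Fin d → Prop) : Set (Fin d → ℝ) :=
  {x | (∀ i, x i ∈ Set.Icc 0 1) ∧ ∀ i j, r i j → x i ≤ x j}

/-- The relation obtained from `r` by adjoining an incomparable last element. Its order polytope is
the prism over the order polytope of `r`. -/
def addIsolated {d : ℕ} (r : Fin d → Fin d → Prop) : Fin (d + 1) → Fin (d + 1) → Prop :=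
  Relation.Map r Fin.castSucc Fin.castSucc

theorem finite_setOfPred_forall_eq_zero_or_one {ι M : Type*} [Finite ι] [Zero M] [One M] :
    {v : ι → M | ∀ i, v i = 0 ∨ v i = 1}.Finite :=
  Set.Finite.pi' (t := fun _ => {0, 1}) fun _ => Set.toFinite _

theorem IsZeroOnePolytope.isLatticePolytope {d : ℕ} {P : Set (Fin d → ℝ)}
    (h : IsZeroOnePolytope P) : IsLatticePolytope P := by
  obtain ⟨V, hV, h01, rfl⟩ := h
  have hsub : V ⊆ intPoint '' {z | ∀ i, z i = 0 ∨ z i = 1} := fun v hv =>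
    ⟨fun i => ⌊v i⌋, fun i => by rcases h01 v hv i with h | h <;> simp [h],
      funext fun i => by rcases h01 v hv i with h | h <;> simp [intPoint, h]⟩
  obtain ⟨W, hW, rfl⟩ := Set.subset_image_iff.1 hsub
  lift W to Finset (Fin d → ℤ) using finite_setOfPred_forall_eq_zero_or_one.subset hW
  exact ⟨W, by simpa using hV, rfl⟩

theorem isZeroOnePolytope_of_extremePoints {d : ℕ} {P : Set (Fin d → ℝ)} (hcomp : IsCompact P)
    (hconv : Convex ℝ P) (hne : P.Nonempty)
    (hext : ∀ v ∈ P.extremePoints ℝ, ∀ i, v i = 0 ∨ v i = 1) : IsZeroOnePolytope P := by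
  refine ⟨P.extremePoints ℝ, hcomp.extremePoints_nonempty hne, hext, ?_⟩
  have hfin : (P.extremePoints ℝ).Finite := finite_setOfPred_forall_eq_zero_or_one.subset hext
  rw [← (hfin.isClosed_convexHull ℝ).closure_eq, closure_convexHull_extremePoints hcomp hconv]

theorem isCompact_relOrderPolytope {d : ℕ} (r : Fin d → Fin d → Prop) :
    IsCompact (relOrderPolytope r) := by
  refine (isCompact_univ_pi fun _ : Fin d => isCompact_Icc (a := (0 : ℝ)) (b := 1))
    |>.of_isClosed_subset ?_ fun x hx i _ => hx.1 i
  simp only [relOrderPolytope, Set.mem_Icc, Set.ofPred_and, Set.ofPred_forall]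
  refine IsClosed.inter ?_ ?_
  · exact isClosed_iInter fun i => (isClosed_le (by fun_prop) (by fun_prop)).inter
      (isClosed_le (by fun_prop) (by fun_prop))
  · exact isClosed_iInter fun i => isClosed_iInter fun j => isClosed_iInter fun _ =>
      isClosed_le (by fun_prop) (by fun_prop)

theorem convex_relOrderPolytope {d : ℕ} (r : Fin d → Fin d → Prop) :
    Convex ℝ (relOrderPolytope r) := by
  rintro x ⟨hx, hxr⟩ y ⟨hy, hyr⟩ a b ha hb hab
  exact ⟨fun i => convex_Icc 0 1 (hx i) (hy i) ha hb hab, fun i j hij =>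
    add_le_add (mul_le_mul_of_nonneg_left (hxr i j hij) ha)
      (mul_le_mul_of_nonneg_left (hyr i j hij) hb)⟩

theorem eq_zero_or_one_of_mem_extremePoints {d : ℕ} {r : Fin d → Fin d → Prop} {x : Fin d → ℝ}
    (hx : x ∈ (relOrderPolytope r).extremePoints ℝ) (i : Fin d) : x i = 0 ∨ x i = 1 := by
  obtain ⟨⟨h01, hr⟩, hmin⟩ := mem_extremePoints_iff_left.1 hx
  -- `t ↦ t ^ 2` and `t ↦ 2 * t - t ^ 2` are monotone maps of `[0, 1]` to itself with mean `t`.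
  have hsq : (fun i => x i ^ 2) ∈ relOrderPolytope r :=
    ⟨fun i => ⟨sq_nonneg _, pow_le_one₀ (h01 i).1 (h01 i).2⟩,
      fun i j hij => pow_le_pow_left₀ (h01 i).1 (hr i j hij) 2⟩
  have hsq' : (fun i => 2 * x i - x i ^ 2) ∈ relOrderPolytope r :=
    ⟨fun i => ⟨by nlinarith [(h01 i).1, (h01 i).2], by nlinarith [sq_nonneg (x i - 1)]⟩,
      fun i j hij => by nlinarith [hr i j hij, (h01 i).2, (h01 j).2]⟩
  have hseg : x ∈ openSegment ℝ (fun i => x i ^ 2) (fun i => 2 * x i - x i ^ 2) :=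
    ⟨1 / 2, 1 / 2, by norm_num, by norm_num, by norm_num, funext fun i => by
      simp only [Pi.add_apply, Pi.smul_apply, smul_eq_mul]; ring⟩
  have heq : x i ^ 2 = x i := congrFun (hmin _ hsq _ hsq' hseg) i
  exact eq_zero_or_one_of_sq_eq_self heq

theorem isZeroOnePolytope_relOrderPolytope {d : ℕ} (r : Fin d → Fin d → Prop) :
    IsZeroOnePolytope (relOrderPolytope r) :=
  isZeroOnePolytope_of_extremePoints (isCompact_relOrderPolytope r) (convex_relOrderPolytope r)
    ⟨0, by simp [relOrderPolytope]⟩ fun _ => eq_zero_or_one_of_mem_extremePoints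

theorem polytopeDim_relOrderPolytope {d : ℕ} {r : Fin d → Fin d → Prop}
    (hr : ∀ i j, r i j → i ≤ j) : polytopeDim (relOrderPolytope r) = d := by
  let U : Set (Fin d → ℝ) := {x | (∀ i, 0 < x i ∧ x i < 1) ∧ ∀ i j, i < j → x i < x j}
  have hU : IsOpen U := by
    simp only [U, Set.ofPred_and, Set.ofPred_forall]
    refine IsOpen.inter (isOpen_iInter_of_finite fun i => ?_) (isOpen_iInter_of_finite fun i =>
      isOpen_iInter_of_finite fun j => isOpen_iInter_of_finite fun _ => ?_)
    · exact (isOpen_lt (by fun_prop) (by fun_prop)).inter (isOpen_lt (by fun_prop) (by fun_prop))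
    · exact isOpen_lt (by fun_prop) (by fun_prop)
  have hne : U.Nonempty := by
    refine ⟨fun i => (i + 1 : ℝ) / (d + 1), fun i => ⟨by positivity, ?_⟩, fun i j hij => ?_⟩
    · rw [div_lt_one (by positivity)]
      exact_mod_cast Nat.succ_lt_succ i.isLt
    · exact div_lt_div_of_pos_right (by simpa using hij) (by positivity)
  have hsub : U ⊆ relOrderPolytope r := fun x hx =>
    ⟨fun i => ⟨(hx.1 i).1.le, (hx.1 i).2.le⟩, fun i j hij =>
      (hr i j hij).eq_or_lt.elim (fun h => h ▸ le_rfl) fun h => (hx.2 i j h).le⟩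
  have htop : affineSpan ℝ (relOrderPolytope r) = ⊤ :=
    top_unique ((hU.affineSpan_eq_top hne).ge.trans (affineSpan_mono ℝ hsub))
  rw [polytopeDim, AffineSubspace.vectorSpan_eq_top_of_affineSpan_eq_top ℝ _ _ htop, finrank_top,
    Module.finrank_fin_fun]

theorem intPoint_mem_smul_relOrderPolytope {d n : ℕ} (hn : 1 ≤ n) (r : Fin d → Fin d → Prop)
    (z : Fin d → ℤ) : intPoint z ∈ (n : ℝ) • relOrderPolytope r ↔
      (∀ i, z i ∈ Set.Icc 0 (n : ℤ)) ∧ ∀ i j, r i j → z i ≤ z j := by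
  have hn0 : (0 : ℝ) < n := by exact_mod_cast hn
  rw [Set.mem_smul_set_iff_inv_smul_mem₀ hn0.ne']
  refine and_congr (forall_congr' fun i => and_congr ?_ ?_) (forall₃_congr fun i j _ => ?_) <;>
    simp only [Pi.smul_apply, smul_eq_mul, intPoint]
  · rw [mul_nonneg_iff_of_pos_left (inv_pos.2 hn0), Int.cast_nonneg_iff]
  · rw [inv_mul_le_one₀ hn0]
    exact_mod_cast Iff.rfl
  · rw [mul_le_mul_iff_right₀ (inv_pos.2 hn0), Int.cast_le]

theorem latticeCount_relOrderPolytope {d n : ℕ} (hn : 1 ≤ n) (r : Fin d → Fin d → Prop) :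
    latticeCount (relOrderPolytope r) n =
      Nat.card (r →r (LE.le : Fin (n + 1) → Fin (n + 1) → Prop)) := by
  rw [latticeCount, ← Nat.card_coe_set_eq]
  simp only [intPoint_mem_smul_relOrderPolytope hn]
  exact Nat.card_congr
    { toFun z := ⟨fun i => ⟨(z.1 i).toNat, by have := z.2.1 i; grind⟩,
        fun {i j} hij => Int.toNat_le_toNat (z.2.2 i j hij)⟩
      invFun f := ⟨fun i => (f i : ℕ), fun i => by grind, fun i j hij => by
        exact Int.ofNat_le.2 (f.map_rel hij)⟩
      left_inv z := Subtype.ext (funext fun i => Int.toNat_of_nonneg (z.2.1 i).1)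
      right_inv f := RelHom.ext fun i => Fin.ext (Int.toNat_natCast _) }

/-- A map out of `addIsolated r` is a map out of `r` with an arbitrary value at the new element. -/
def addIsolatedRelHomEquiv {d : ℕ} {β : Type*} (r : Fin d → Fin d → Prop) (s : β → β → Prop) :
    (addIsolated r →r s) ≃ β × (r →r s) where
  toFun f := ⟨f (Fin.last d), ⟨fun i => f i.castSucc, fun h => f.map_rel ⟨_, _, h, rfl, rfl⟩⟩⟩
  invFun p := ⟨Fin.snoc p.2 p.1, by
    rintro _ _ ⟨i, j, hij, rfl, rfl⟩
    simpa using p.2.map_rel hij⟩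
  left_inv f := RelHom.ext fun i => by refine Fin.lastCases ?_ (fun i => ?_) i <;> simp
  right_inv p := by ext <;> simp

theorem IsEhrhartPolynomial.addIsolated {d : ℕ} {r : Fin d → Fin d → Prop} {p : ℝ[X]}
    (h : IsEhrhartPolynomial (relOrderPolytope r) p) :
    IsEhrhartPolynomial (relOrderPolytope (addIsolated r)) ((X + C 1) * p) := by
  intro n hn
  rw [latticeCount_relOrderPolytope hn, Nat.card_congr (addIsolatedRelHomEquiv r _), Nat.card_prod,
    ← latticeCount_relOrderPolytope hn, eval_mul, h n hn]
  simp

theorem orderPolytope_eq_relOrderPolytope (d : ℕ) :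
    orderPolytope d = relOrderPolytope fun i _ => i.val = 0 := by
  ext x
  refine ⟨fun h => ⟨fun k => ?_, fun i k hi => (h i k hi).2.1⟩,
    fun h i k hi => ⟨(h.1 i).1, h.2 i k hi, (h.1 k).2⟩⟩
  obtain ⟨h0, h0k, hk1⟩ := h ⟨0, k.pos⟩ k rfl
  exact ⟨h0.trans h0k, hk1⟩

theorem isZeroOnePolytope_orderPolytope (d : ℕ) : IsZeroOnePolytope (orderPolytope d) :=
  orderPolytope_eq_relOrderPolytope d ▸ isZeroOnePolytope_relOrderPolytope _

theorem polytopeDim_orderPolytope (d : ℕ) : polytopeDim (orderPolytope d) = d := by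
  rw [orderPolytope_eq_relOrderPolytope]
  exact polytopeDim_relOrderPolytope fun i j hi => Fin.le_def.2 (hi ▸ Nat.zero_le j)

/-- A map out of the relation `0 ≤ k` on `Fin (e + 1)` is a value `a` at `0` together with a map
from the remaining `e` elements to the values above `a`. -/
def minRelHomEquiv (e : ℕ) {β : Type*} [Preorder β] :
    ((fun i _ : Fin (e + 1) => i.val = 0) →r (LE.le : β → β → Prop)) ≃
      Σ a : β, Fin e → Set.Ici a where
  toFun f := ⟨f 0, fun k => ⟨f k.succ, f.map_rel rfl⟩⟩
  invFun p := ⟨Fin.cons p.1 fun k => (p.2 k).1, by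
    intro i k hi
    obtain rfl : i = 0 := Fin.ext hi
    exact Fin.cases le_rfl (fun k => (p.2 k).2) k⟩
  left_inv f := RelHom.ext <| Fin.cases rfl fun _ => rfl
  right_inv _ := rfl

theorem latticeCount_orderPolytope_succ (e : ℕ) {n : ℕ} (hn : 1 ≤ n) :
    latticeCount (orderPolytope (e + 1)) n = ∑ j ∈ Finset.range (n + 1), (j + 1) ^ e := by
  rw [orderPolytope_eq_relOrderPolytope, latticeCount_relOrderPolytope hn,
    Nat.card_congr (minRelHomEquiv e), Nat.card_sigma, ← Finset.sum_range_reflect,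
    ← Fin.sum_univ_eq_sum_range (fun j => (n + 1 - 1 - j + 1) ^ e)]
  refine Finset.sum_congr rfl fun j _ => ?_
  rw [Nat.card_fun, Nat.card_fin, Nat.card_eq_fintype_card, Fintype.card_Ici, Fin.card_Ici]
  congr 1
  omega

theorem bernoulliFun_one_add (d : ℕ) (x : ℝ) :
    bernoulliFun d (1 + x) = bernoulliFun d x + d * x ^ (d - 1) := by
  have h := congrArg (fun p : ℚ[X] => (p.map (algebraMap ℚ ℝ)).eval x)
    (Polynomial.bernoulli_comp_one_add_X d)
  simpa [bernoulliFun, Polynomial.map_comp] using h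

theorem bernoulliFun_add_natCast (d m : ℕ) (x : ℝ) :
    bernoulliFun d (x + m) =
      bernoulliFun d x + d * ∑ j ∈ Finset.range m, (x + j) ^ (d - 1) := by
  induction m with
  | zero => simp
  | succ m ih =>
    rw [Nat.cast_succ, ← add_assoc, add_comm (x + m), bernoulliFun_one_add, ih,
      Finset.sum_range_succ, mul_add, add_assoc]

theorem bernoulliFun_zero_le_natCast (d m : ℕ) : bernoulliFun d 0 ≤ bernoulliFun d m := by
  have h := bernoulliFun_add_natCast d m 0
  simp only [zero_add] at h
  rw [h]
  exact le_add_of_nonneg_right (by positivity)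

theorem bernoulliFun_add_natCast_le (d m : ℕ) {x : ℝ} (hx : 0 ≤ x) :
    bernoulliFun d (x + m) ≤ bernoulliFun d x + (x + m) ^ d := by
  induction m with
  | zero => simpa using pow_nonneg hx d
  | succ m ih =>
    have hpow := pow_add_mul_le_add_pow (show 0 ≤ x + m by positivity)
      (show 0 ≤ 2 * (x + m) + 1 by positivity) d
    rw [Nat.cast_succ, ← add_assoc, add_comm (x + m) 1, bernoulliFun_one_add, add_comm 1]
    linarith

theorem eval_bernoulliEhrhart (d : ℕ) (x : ℝ) :
    (bernoulliEhrhart d).eval x = (d : ℝ)⁻¹ * (bernoulliFun d (x + 2) - bernoulliFun d 0) := by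
  simp [bernoulliEhrhart, bernoulliFun]

theorem eval_natCast_bernoulliEhrhart (e n : ℕ) :
    (bernoulliEhrhart (e + 1)).eval (n : ℝ) = ∑ j ∈ Finset.range (n + 2), (j : ℝ) ^ e := by
  have h := bernoulliFun_add_natCast (e + 1) (n + 2) 0
  simp only [zero_add, Nat.cast_add n, Nat.cast_ofNat] at h
  rw [eval_bernoulliEhrhart, h, add_sub_cancel_left, inv_mul_cancel_left₀ (by positivity),
    Nat.add_sub_cancel]

theorem natDegree_bernoulli (d : ℕ) : (Polynomial.bernoulli d).natDegree = d := by
  refine natDegree_eq_of_le_of_coeff_ne_zero (natDegree_le_iff_coeff_eq_zero.2 fun i hi => ?_) ?_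
  · rw [Polynomial.coeff_bernoulli, if_neg (by omega)]
  · simp [Polynomial.coeff_bernoulli]

theorem natDegree_bernoulliEhrhart {d : ℕ} (hd : d ≠ 0) : (bernoulliEhrhart d).natDegree = d := by
  simp only [bernoulliEhrhart]
  rw [natDegree_C_mul (by simpa using hd), natDegree_sub_C, natDegree_comp, natDegree_X_add_C,
    mul_one, natDegree_map, natDegree_bernoulli]

theorem isEhrhartPolynomial_orderPolytope {d : ℕ} (hd : 2 ≤ d) :
    IsEhrhartPolynomial (orderPolytope d) (bernoulliEhrhart d) := by
  obtain ⟨e, rfl⟩ : ∃ e, d = e + 2 := ⟨d - 2, by omega⟩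
  intro n hn
  rw [latticeCount_orderPolytope_succ _ hn, eval_natCast_bernoulliEhrhart, Finset.sum_range_succ']
  simp

theorem isEhrhartPolynomial_orderPolytope_one :
    IsEhrhartPolynomial (orderPolytope 1) (X + C 1) := fun n hn => by
  simp [latticeCount_orderPolytope_succ 0 hn]

/-- The cosine and sine Fourier expansions of the even and odd Bernoulli functions, written
uniformly in the parity of `d`. -/
theorem hasSum_cos_sub_natCast_mul_pi_div_two {d : ℕ} (hd : 2 ≤ d) {x : ℝ}
    (hx : x ∈ Set.Icc (0 : ℝ) 1) :
    HasSum (fun n : ℕ => 1 / (n : ℝ) ^ d * Real.cos (2 * π * n * x - d * (π / 2)))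
      (-((2 * π) ^ d / 2 / d ! * bernoulliFun d x)) := by
  have hsign (k : ℕ) : (-1 : ℝ) ^ k * (-1) ^ (k + 1) = -1 := by
    rw [← pow_add, Odd.neg_one_pow ⟨k, by ring⟩]
  rcases Nat.even_or_odd' d with ⟨k, rfl | rfl⟩
  · convert! (hasSum_one_div_nat_pow_mul_cos (k := k) (by omega) hx).mul_left ((-1) ^ k) using 1
    · ext n
      rw [mul_left_comm, ← Real.cos_sub_nat_mul_pi]
      congr 2
      push_cast
      ring
    · rw [bernoulliFun]
      linear_combination (-((2 * π) ^ (2 * k) / 2 / (2 * k)! *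
        ((Polynomial.bernoulli (2 * k)).map (algebraMap ℚ ℝ)).eval x)) * hsign k
  · convert! (hasSum_one_div_nat_pow_mul_sin (k := k) (by omega) hx).mul_left ((-1) ^ k) using 1
    · ext n
      rw [mul_left_comm, ← Real.cos_sub_pi_div_two, ← Real.cos_sub_nat_mul_pi]
      congr 2
      push_cast
      ring
    · rw [bernoulliFun]
      linear_combination (-((2 * π) ^ (2 * k + 1) / 2 / (2 * k + 1)! *
        ((Polynomial.bernoulli (2 * k + 1)).map (algebraMap ℚ ℝ)).eval x)) * hsign k

theorem cos_natCast_mul_pi_div_two_nonpos {d : ℕ} (h4 : ¬ 4 ∣ d) :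
    Real.cos (d * (π / 2)) ≤ 0 := by
  rcases Nat.even_or_odd' d with ⟨k, rfl | rfl⟩
  · have hk : Odd k := by
      rw [← Nat.not_even_iff_odd, even_iff_two_dvd]
      omega
    rw [show ((2 * k : ℕ) : ℝ) * (π / 2) = k * π by push_cast; ring, Real.cos_nat_mul_pi,
      hk.neg_one_pow]
    norm_num
  · exact (Real.cos_eq_zero_iff.2 ⟨k, by push_cast; ring⟩).le

theorem one_fourth_le_of_hasSum_one_div_pow_mul {d : ℕ} (hd : 2 ≤ d) {g : ℕ → ℝ} {S : ℝ}
    (hg : ∀ n, -1 ≤ g n) (hg1 : 1 ≤ g 1) (hS : HasSum (fun n : ℕ => 1 / (n : ℝ) ^ d * g n) S) :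
    1 / 4 ≤ S := by
  -- The terms with `n ≥ 2` cost at most `ζ(2) - 1 < 3 / 4`.
  have hterm : ∀ n : ℕ, 0 ≤ 1 / (n : ℝ) ^ d * g n + 1 / (n : ℝ) ^ 2 := by
    intro n
    rcases n.eq_zero_or_pos with rfl | hn
    · simp [show d ≠ 0 by omega]
    · have hn1 : (1 : ℝ) ≤ n := by exact_mod_cast hn
      have hpow : 1 / (n : ℝ) ^ d ≤ 1 / (n : ℝ) ^ 2 := by gcongr
      have hmul := mul_le_mul_of_nonneg_left (hg n) (show 0 ≤ 1 / (n : ℝ) ^ d by positivity)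
      linarith
  have hle := le_hasSum (hS.add hasSum_zeta_two) 1 fun n _ => hterm n
  norm_num at hle
  nlinarith [Real.pi_lt_d2, Real.pi_pos]

theorem exists_bernoulliFun_add_le_bernoulliFun_zero {d : ℕ} (hd : 2 ≤ d) (h4 : ¬ 4 ∣ d) :
    ∃ y ∈ Set.Icc (0 : ℝ) 1,
      bernoulliFun d y + d ! / (2 * (2 * π) ^ d) ≤ bernoulliFun d 0 := by
  set y : ℝ := ((d % 4 : ℕ) : ℝ) / 4 with hy
  have hy01 : y ∈ Set.Icc (0 : ℝ) 1 := by
    have : ((d % 4 : ℕ) : ℝ) ≤ 4 := by exact_mod_cast (Nat.mod_lt d (by norm_num)).le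
    exact ⟨by positivity, by rw [hy]; linarith⟩
  have hcos1 : Real.cos (2 * π * (1 : ℕ) * y - d * (π / 2)) = 1 := by
    have hd4 : (d : ℝ) = (d % 4 : ℕ) + 4 * (d / 4 : ℕ) := by
      exact_mod_cast (Nat.mod_add_div d 4).symm
    rw [← Real.cos_neg, ← Real.cos_nat_mul_two_pi (d / 4)]
    congr 1
    rw [hd4, hy]
    push_cast
    ring
  have hcos0 := cos_natCast_mul_pi_div_two_nonpos h4
  have hsum := (hasSum_cos_sub_natCast_mul_pi_div_two hd hy01).sub
    (hasSum_cos_sub_natCast_mul_pi_div_two hd (x := 0) (by simp))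
  simp only [← mul_sub, mul_zero, zero_sub, Real.cos_neg] at hsum
  have hquarter := one_fourth_le_of_hasSum_one_div_pow_mul hd
    (fun n => by linarith [Real.neg_one_le_cos (2 * π * n * y - d * (π / 2))])
    (by rw [hcos1]; linarith) hsum
  refine ⟨y, hy01, ?_⟩
  have hdip : d ! / (2 * (2 * π) ^ d) = 2 * d ! / (2 * π) ^ d * (1 / 4) := by ring
  have hscale : bernoulliFun d 0 - bernoulliFun d y = 2 * d ! / (2 * π) ^ d *
      (-((2 * π) ^ d / 2 / d ! * bernoulliFun d y) -
        -((2 * π) ^ d / 2 / d ! * bernoulliFun d 0)) := by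
    field_simp
    ring
  rw [add_comm, ← le_sub_iff_add_le, hdip, hscale]
  gcongr

theorem exists_bernoulliFun_eq_bernoulliFun_zero {d m : ℕ} (hd : 2 ≤ d) (h4 : ¬ 4 ∣ d)
    (hm : ((m : ℝ) + 1) ^ d ≤ d ! / (2 * (2 * π) ^ d)) :
    ∃ x ∈ Set.Icc (m : ℝ) (m + 1), bernoulliFun d x = bernoulliFun d 0 := by
  obtain ⟨y, ⟨hy0, hy1⟩, hy⟩ := exists_bernoulliFun_add_le_bernoulliFun_zero hd h4
  have hright : bernoulliFun d (y + m) ≤ bernoulliFun d 0 :=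
    calc bernoulliFun d (y + m) ≤ bernoulliFun d y + (y + m) ^ d :=
          bernoulliFun_add_natCast_le d m hy0
      _ ≤ bernoulliFun d y + (m + 1) ^ d := by gcongr _ + ?_ ^ d; linarith
      _ ≤ bernoulliFun d 0 := by linarith
  obtain ⟨x, hx, hxe⟩ := intermediate_value_Icc' (show (m : ℝ) ≤ y + m by linarith)
    (continuous_bernoulliFun d).continuousOn ⟨hright, bernoulliFun_zero_le_natCast d m⟩
  exact ⟨x, ⟨hx.1, hx.2.trans (by linarith)⟩, hxe⟩

theorem pow_le_factorial_div_two_mul_two_pi_pow {d : ℕ} {c : ℝ} (hd : 1 ≤ d) (hc0 : 0 ≤ c)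
    (hc : c ≤ (d - Real.log 2) / (2 * π * Real.exp 1)) :
    c ^ d ≤ d ! / (2 * (2 * π) ^ d) := by
  have hd0 : (0 : ℝ) < d := by exact_mod_cast hd
  have hlog : Real.log 2 ≤ d :=
    (Real.log_two_lt_d9.le.trans (by norm_num)).trans (Nat.one_le_cast.2 hd)
  have hhalf : (1 - Real.log 2 / d) ^ d ≤ 1 / 2 := by
    simpa [Real.exp_neg, Real.exp_log] using Real.one_sub_div_pow_le_exp_neg hlog
  have hfac : (d : ℝ) ^ d ≤ d ! * Real.exp 1 ^ d := by
    have := Real.pow_div_factorial_le_exp (d : ℝ) hd0.le d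
    rwa [div_le_iff₀' (by positivity), ← Real.exp_one_pow] at this
  calc c ^ d ≤ ((d - Real.log 2) / (2 * π * Real.exp 1)) ^ d := by gcongr
    _ = (1 - Real.log 2 / d) ^ d * d ^ d / (2 * π * Real.exp 1) ^ d := by
      rw [← mul_pow, ← div_pow]; field_simp
    _ ≤ 1 / 2 * (d ! * Real.exp 1 ^ d) / (2 * π * Real.exp 1) ^ d := by gcongr
    _ = d ! / (2 * (2 * π) ^ d) := by rw [mul_pow (2 * π)]; field_simp

theorem one_div_two_pi_exp_bounds :
    0.0585 < 1 / (2 * π * Real.exp 1) ∧ 1 / (2 * π * Real.exp 1) < 0.0586 := by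
  have h1 := Real.pi_gt_d4
  have h2 := Real.pi_lt_d4
  have h3 := Real.exp_one_gt_d9
  have h4 := Real.exp_one_lt_d9
  constructor
  · rw [lt_div_iff₀ (by positivity)]
    nlinarith
  · rw [div_lt_iff₀ (by positivity)]
    nlinarith

theorem isRoot_bernoulliEhrhart_sub_two {d : ℕ} {x : ℝ}
    (hx : bernoulliFun d x = bernoulliFun d 0) :
    (bernoulliEhrhart d).IsRoot (x - 2) := by
  rw [IsRoot.def, eval_bernoulliEhrhart, sub_add_cancel, hx, sub_self, mul_zero]

theorem exists_isRoot_bernoulliEhrhart_near {d : ℕ} (hd : 2 ≤ d) (h4 : ¬ 4 ∣ d) :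
    ∃ x, (bernoulliEhrhart d).IsRoot x ∧ |x - d * (1 / (2 * π * Real.exp 1))| ≤ 5 := by
  obtain ⟨hL0, hL1⟩ := one_div_two_pi_exp_bounds
  have hlog0 := Real.log_two_gt_d9
  have hlog1 := Real.log_two_lt_d9
  set L := 1 / (2 * π * Real.exp 1) with hL
  have hdL : (d - Real.log 2) / (2 * π * Real.exp 1) = d * L - Real.log 2 * L := by
    rw [hL]; ring
  have hδ : Real.log 2 * L ∈ Set.Icc (0 : ℝ) 1 := ⟨by positivity, by nlinarith⟩
  obtain hsmall | hlarge := lt_or_ge (d * L - Real.log 2 * L) 1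
  · refine ⟨0 - 2, isRoot_bernoulliEhrhart_sub_two rfl, ?_⟩
    have : 0 ≤ d * L := by positivity
    rw [abs_le]
    constructor <;> linarith [hδ.1, hδ.2]
  · obtain ⟨m, hm⟩ := Nat.exists_eq_add_of_le' (Nat.one_le_floor_iff _ |>.2 hlarge)
    have hle : (m : ℝ) + 1 ≤ d * L - Real.log 2 * L := by
      exact_mod_cast hm ▸ Nat.floor_le (zero_le_one.trans hlarge)
    have hlt : d * L - Real.log 2 * L < (m : ℝ) + 1 + 1 := by
      exact_mod_cast hm ▸ Nat.lt_floor_add_one (d * L - Real.log 2 * L)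
    obtain ⟨x, ⟨hmx, hxm⟩, hx⟩ := exists_bernoulliFun_eq_bernoulliFun_zero hd h4
      (pow_le_factorial_div_two_mul_two_pi_pow (by omega) (by positivity) (hle.trans_eq hdL.symm))
    refine ⟨x - 2, isRoot_bernoulliEhrhart_sub_two hx, abs_le.2 ?_⟩
    constructor <;> linarith [hδ.1, hδ.2]

theorem exists_zeroOnePolytope_isRoot_near {d : ℕ} (hd : 1 ≤ d) :
    ∃ (P : Set (Fin d → ℝ)) (p : ℝ[X]) (x : ℝ), IsZeroOnePolytope P ∧ polytopeDim P = d ∧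
      IsEhrhartPolynomial P p ∧ p.natDegree = d ∧ p.IsRoot x ∧
      |x - d * (1 / (2 * π * Real.exp 1))| ≤ 6 ∧ (¬ 4 ∣ d → P = orderPolytope d) := by
  obtain ⟨hL0, hL1⟩ := one_div_two_pi_exp_bounds
  obtain rfl | hd2 := hd.eq_or_lt
  · refine ⟨_, _, -1, isZeroOnePolytope_orderPolytope 1, polytopeDim_orderPolytope 1,
      isEhrhartPolynomial_orderPolytope_one, natDegree_X_add_C 1, by simp, ?_, fun _ => rfl⟩
    rw [abs_le]
    constructor <;> norm_num at * <;> linarith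
  by_cases h4 : 4 ∣ d
  · obtain ⟨e, rfl⟩ : ∃ e, d = e + 1 := ⟨d - 1, by omega⟩
    obtain ⟨x, hx, hnear⟩ := exists_isRoot_bernoulliEhrhart_near (d := e) (by omega) (by omega)
    have he : (bernoulliEhrhart e).natDegree = e := natDegree_bernoulliEhrhart (by omega)
    have hne : bernoulliEhrhart e ≠ 0 := ne_zero_of_natDegree_gt (n := 0) (by omega)
    refine ⟨_, _, x, isZeroOnePolytope_relOrderPolytope _, polytopeDim_relOrderPolytope ?_,
      (orderPolytope_eq_relOrderPolytope e ▸
        isEhrhartPolynomial_orderPolytope (by omega)).addIsolated, ?_, root_mul_left_of_isRoot _ hx,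
      ?_, absurd h4⟩
    · rintro _ _ ⟨i, j, hij, rfl, rfl⟩
      exact Fin.le_def.2 (by simp [hij])
    · rw [natDegree_mul (X_add_C_ne_zero 1) hne, natDegree_X_add_C, he, add_comm]
    · rw [abs_le] at hnear ⊢
      push_cast
      constructor <;> linarith
  · obtain ⟨x, hx, hnear⟩ := exists_isRoot_bernoulliEhrhart_near hd2 h4
    exact ⟨_, _, x, isZeroOnePolytope_orderPolytope d, polytopeDim_orderPolytope d,
      isEhrhartPolynomial_orderPolytope hd2, natDegree_bernoulliEhrhart (by omega), hx,
      hnear.trans (by norm_num), fun _ => rfl⟩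

theorem theorem1p3 :
    -- arbitrarily large real roots, in every sufficiently large degree
    (∀ t : ℝ, 0 < t → ∀ᶠ d : ℕ in atTop,
      ∃ (P : Set (Fin d → ℝ)) (p : ℝ[X]), IsLatticePolytope P ∧ polytopeDim P = d ∧
        IsEhrhartPolynomial P p ∧ p.natDegree = d ∧ ∃ x : ℝ, p.IsRoot x ∧ t < x) ∧
    -- 0/1-polytopes with a real zero of linear growth; order polytopes if 4 does not divide d
    (∃ α : ℕ → ℝ,
      (∀ d : ℕ, 1 ≤ d → ∃ (P : Set (Fin d → ℝ)) (p : ℝ[X]),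
        IsZeroOnePolytope P ∧ polytopeDim P = d ∧ IsEhrhartPolynomial P p ∧ p.IsRoot (α d) ∧
        (¬ 4 ∣ d → P = orderPolytope d)) ∧
      Tendsto (fun d : ℕ => α d / (d : ℝ)) atTop (𝓝 (1 / (2 * Real.pi * Real.exp 1)))) ∧
    -- the order polytopes and their Ehrhart polynomials
    (∀ d : ℕ, 1 ≤ d → IsZeroOnePolytope (orderPolytope d) ∧ polytopeDim (orderPolytope d) = d) ∧
    (∀ d : ℕ, 2 ≤ d → IsEhrhartPolynomial (orderPolytope d) (bernoulliEhrhart d)) ∧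
    -- the decimal value 0.0585…
    (0.0585 < 1 / (2 * Real.pi * Real.exp 1) ∧ 1 / (2 * Real.pi * Real.exp 1) < 0.0586) := by
  set L := 1 / (2 * Real.pi * Real.exp 1)
  have hL0 : 0 < L := by positivity
  refine ⟨fun t _ => ?_, ?_, fun d _ => ⟨isZeroOnePolytope_orderPolytope d,
    polytopeDim_orderPolytope d⟩, fun d => isEhrhartPolynomial_orderPolytope,
    one_div_two_pi_exp_bounds⟩
  · have hgrow : Tendsto (fun d : ℕ => d * L) atTop atTop :=
      tendsto_natCast_atTop_atTop.atTop_mul_const hL0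
    filter_upwards [eventually_ge_atTop 1, hgrow.eventually_gt_atTop (t + 6)] with d hd hdt
    obtain ⟨P, p, x, hP, hdim, hp, hdeg, hx, hnear, -⟩ := exists_zeroOnePolytope_isRoot_near hd
    exact ⟨P, p, hP.isLatticePolytope, hdim, hp, hdeg, x, hx, by linarith [(abs_le.1 hnear).1]⟩
  · choose! P p α hP hdim hp _ hα hnear hord using
      fun d => exists_zeroOnePolytope_isRoot_near (d := d)
    refine ⟨α, fun d hd => ⟨P d, p d, hP d hd, hdim d hd, hp d hd, hα d hd, hord d hd⟩, ?_⟩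
    refine tendsto_iff_dist_tendsto_zero.2 (squeeze_zero' (.of_forall fun _ => dist_nonneg) ?_
      (tendsto_const_div_atTop_nhds_zero_nat 6))
    filter_upwards [eventually_ge_atTop 1] with d hd
    have hd0 : (0 : ℝ) < d := by exact_mod_cast hd
    calc dist (α d / d) L = |α d - d * L| / d := by
          rw [Real.dist_eq, div_sub' hd0.ne', abs_div, Nat.abs_cast]
      _ ≤ 6 / d := by gcongr; exact hnear d hd
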